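/- **Setting.** $V^1$ is the two-sorted theory of bounded arithmetic (numbers and finite sets of numbers, language $0,1,+,\cdot,|\ |,=,\le,\in$) axiomatized by 2-BASIC, comprehension for $\Sigma^{1,b}_0$-formulas and number induction for $\Sigma^{1,b}_1$-formulas. All objects below are coded by sets of numbers through a pairing function $\langle x,y\rangle$. An *instance* $\Theta=(\mathcal X,\ddot{\mathcal A})$ consists of a digraph $\mathcal X=(V_{\mathcal X},E_{\mathcal X})$ with $V_{\mathcal X}=\{0,\dots,n-1\}$ and of a target digraph with domains $\ddot{\mathcal A}=(V_{\ddot{\mathcal A}},E_{\ddot{\mathcal A}})$. Here $V_{\ddot{\mathcal A}}$ consists of the pairs $\langle i,a\rangle$ with $a\in D_i$, for domains $D_0,\dots,D_{n-1}\subseteq\{0,\dots,l-1\}$, and $E_{\ddot{\mathcal A}}$ is a binary relation on $V_{\ddot{\mathcal A}}$; write $E^{ij}(a,b)$ for $E_{\ddot{\mathcal A}}(\langle i,a\rangle,\langle j,b\rangle)$. For a subgraph $\mathcal X'$ of $\mathcal X$, a *solution* of $(\mathcal X',\ddot{\mathcal A})$ is a homomorphism $H$ from $\mathcal X'$ to $\ddot{\mathcal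 A}$ that sends each vertex $i$ of $\mathcal X'$ to some $\langle i,a\rangle$ with $a\in D_i$. Let $\Omega$ be an $m$-ary operation (for instance a special weak near-unanimity operation under which all the $D_i$ are closed). A congruence $\sigma$ of $(D_i,\Omega)$ is *maximal* if it is not the full relation and no congruence other than the full relation properly contains it. Given a variable $i$ and a maximal congruence $\sigma$ on $D_i$, define relations $I_0,\dots,I_n$ as follows. * $I_0(k,a,b)$ holds iff $k=i$, $a,b\in D_i$ and $\sigma(a,b)$. * $I_{t+1}(k,a,b)$ holds iff $I_t(k,a,b)$ holds or there are $j$, $a'$, $b'$ with $I_t(j,a',b')$ such that the following two conditions hold: 1. $E_{\mathcal X}(j,k)\wedge E^{jk}(a',a)\wedge E^{jk}(b',b)$, or $E_{\mathcal X}(k,j)\wedge E^{kj}(a,a')\wedge E^{kj}(b,b')$; 2. there are no $c,d\in D_j$ and $e\in D_k$ with $\neg I_t(j,c,d)$ such that $E_{\mathcal X}(j,k)\wedge E^{jk}(c,e)\wedge E^{jk}(d,e)$ or $E_{\mathcal X}(k,j)\wedge E^{kj}(e,c)\wedge E^{kj}(e,d)$. Let $\mathcal X'$ be the subgraph of $\mathcal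 X$ induced on $\{k<n : \exists a,b<l\ I_n(k,a,b)\}$. One *irreducibility reduction* of $\ddot{\mathcal A}$ chooses such $i$ and $\sigma$ and a vertex $j$ of $\mathcal X'$. It removes from $D_j$ all elements $a$ such that no solution of the subinstance $(\mathcal X',\ddot{\mathcal A})$ sends $j$ to $\langle j,a\rangle$, together with the edges of $\ddot{\mathcal A}$ at the removed vertices. Let $\ddot{\mathcal A}_{ir}$ be the last member of a sequence (coded by sets) that starts with $\ddot{\mathcal A}$ and in which every member arises from the previous one by one irreducibility reduction; in particular $\ddot{\mathcal A}_{ir}$ may be the target digraph at which the procedure stops because no further reduction is possible. **Lemma.** For every $m$, the theory $V^1$ proves, for all $l$, $n$, $\Omega$, $\Theta=(\mathcal X,\ddot{\mathcal A})$ and all $\ddot{\mathcal A}_{ir}$ obtained from $\ddot{\mathcal A}$ by such a sequence of irreducibility reductions: if $\Theta=(\mathcal X,\ddot{\mathcal A})$ has a solution, then $\Theta_{ir}=(\mathcal X,\ddot{\mathcal A}_{ir})$ has a solution. -/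

import Mathlib

/-! Two-sorted bounded arithmetic: number variables range over numbers, set variables over finite
sets of numbers (binary strings). -/

namespace BoundedArith

/-- Number variables. -/
structure NVar where
  idx : ℕ
  deriving DecidableEq

/-- Set variables. -/
structure SVar where
  idx : ℕ
  deriving DecidableEq

/-- Number terms over `0, 1, +, ·, |X|`; the only set terms are set variables. -/
inductive Tm : Type
  | var (x : NVar)
  | zero
  | one
  | add (s t : Tm)
  | mul (s t : Tm)
  | len (X : SVar)

instance : Coe NVar Tm := ⟨Tm.var⟩
instance : Zero Tm := ⟨Tm.zero⟩
instance : One Tm := ⟨Tm.one⟩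
instance : Add Tm := ⟨Tm.add⟩
instance : Mul Tm := ⟨Tm.mul⟩

/-- Formulas of the two-sorted language `{0, 1, +, ·, | |, =₁, =₂, ≤, ∈}`. -/
inductive Fml : Type
  | eqN (s t : Tm)
  | eqS (X Y : SVar)
  | le (s t : Tm)
  | mem (t : Tm) (X : SVar)
  | neg (φ : Fml)
  | and (φ ψ : Fml)
  | or (φ ψ : Fml)
  | allN (x : NVar) (φ : Fml)
  | exN (x : NVar) (φ : Fml)
  | allS (X : SVar) (φ : Fml)
  | exS (X : SVar) (φ : Fml)

namespace Fml

/-- Implication. -/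
def imp (φ ψ : Fml) : Fml := or (neg φ) ψ

/-- Equivalence. -/
def iff (φ ψ : Fml) : Fml := and (imp φ ψ) (imp ψ φ)

/-- `s < t`. -/
def lt (s t : Tm) : Fml := and (le s t) (neg (eqN s t))

/-- `∀ x ≤ t, φ` (bounded when `x` does not occur in `t`). -/
def allLe (x : NVar) (t : Tm) (φ : Fml) : Fml := allN x (imp (le x t) φ)

/-- `∃ x ≤ t, φ`. -/
def exLe (x : NVar) (t : Tm) (φ : Fml) : Fml := exN x (and (le x t) φ)

/-- `∀ x < t, φ`. -/
def allLt (x : NVar) (t : Tm) (φ : Fml) : Fml := allLe x t (imp (neg (eqN x t)) φ)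

/-- `∃ x < t, φ`. -/
def exLt (x : NVar) (t : Tm) (φ : Fml) : Fml := exLe x t (and (neg (eqN x t)) φ)

/-- `∀ X ≤ t, φ`, where `X ≤ t` means `|X| ≤ t`. -/
def allSLe (X : SVar) (t : Tm) (φ : Fml) : Fml := allS X (imp (le (Tm.len X) t) φ)

/-- `∃ X ≤ t, φ`. -/
def exSLe (X : SVar) (t : Tm) (φ : Fml) : Fml := exS X (and (le (Tm.len X) t) φ)

/-- `∀ X < t, φ`, where `X < t` means `|X| < t`. -/
def allSLt (X : SVar) (t : Tm) (φ : Fml) : Fml :=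
  allSLe X t (imp (neg (eqN (Tm.len X) t)) φ)

/-- `∃ X < t, φ`. -/
def exSLt (X : SVar) (t : Tm) (φ : Fml) : Fml :=
  exSLe X t (and (neg (eqN (Tm.len X) t)) φ)

end Fml

infix:60 " ≐ " => Fml.eqN
infix:60 " <ₙ " => Fml.lt
infix:60 " ≤ₙ " => Fml.le
infix:60 " ∊ " => Fml.mem
infixr:55 " ⩓ " => Fml.and
infixr:52 " ⩔ " => Fml.or
infixr:48 " ⟹ " => Fml.imp
infix:45 " ⟺ " => Fml.iff

/-! ### Variables and substitution -/

/-- The number variable `x` occurs in the term. -/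
def Tm.HasN (x : NVar) : Tm → Prop
  | var y => y = x
  | zero => False
  | one => False
  | add s t => s.HasN x ∨ t.HasN x
  | mul s t => s.HasN x ∨ t.HasN x
  | len _ => False

/-- The set variable `X` occurs in the term. -/
def Tm.HasS (X : SVar) : Tm → Prop
  | var _ => False
  | zero => False
  | one => False
  | add s t => s.HasS X ∨ t.HasS X
  | mul s t => s.HasS X ∨ t.HasS X
  | len Y => Y = X

/-- The set variable `X` occurs free in the formula. -/
def Fml.FreeS (X : SVar) : Fml → Prop
  | eqN s t => s.HasS X ∨ t.HasS X
  | eqS Y Z => Y = X ∨ Z = X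
  | le s t => s.HasS X ∨ t.HasS X
  | mem t Y => t.HasS X ∨ Y = X
  | neg φ => φ.FreeS X
  | and φ ψ => φ.FreeS X ∨ ψ.FreeS X
  | or φ ψ => φ.FreeS X ∨ ψ.FreeS X
  | allN _ φ => φ.FreeS X
  | exN _ φ => φ.FreeS X
  | allS Y φ => Y ≠ X ∧ φ.FreeS X
  | exS Y φ => Y ≠ X ∧ φ.FreeS X

/-- Replace the number variable `x` by the term `u`. -/
def Tm.subst (x : NVar) (u : Tm) : Tm → Tm
  | var y => if y = x then u else var y
  | zero => zero
  | one => one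
  | add s t => add (subst x u s) (subst x u t)
  | mul s t => mul (subst x u s) (subst x u t)
  | len X => len X

/-- Replace the free occurrences of `x` by `u`. It is used only for `u = 0` and `u = x + 1`, where
no variable can be captured. -/
def Fml.subst (x : NVar) (u : Tm) : Fml → Fml
  | eqN s t => eqN (Tm.subst x u s) (Tm.subst x u t)
  | eqS X Y => eqS X Y
  | le s t => le (Tm.subst x u s) (Tm.subst x u t)
  | mem t X => mem (Tm.subst x u t) X
  | neg φ => neg (subst x u φ)
  | and φ ψ => and (subst x u φ) (subst x u ψ)
  | or φ ψ => or (subst x u φ) (subst x u ψ)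
  | allN y φ => if y = x then allN y φ else allN y (subst x u φ)
  | exN y φ => if y = x then exN y φ else exN y (subst x u φ)
  | allS X φ => allS X (subst x u φ)
  | exS X φ => exS X (subst x u φ)

/-! ### The classes `Σ^{1,b}_0`, `Σ^{1,b}_1`, `Π^{1,b}_1` -/

/-- All number quantifiers are bounded and there are no set quantifiers. -/
inductive IsSigma0 : Fml → Prop
  | eqN (s t : Tm) : IsSigma0 (Fml.eqN s t)
  | eqS (X Y : SVar) : IsSigma0 (Fml.eqS X Y)
  | le (s t : Tm) : IsSigma0 (Fml.le s t)
  | mem (t : Tm) (X : SVar) : IsSigma0 (Fml.mem t X)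
  | neg {φ : Fml} : IsSigma0 φ → IsSigma0 (Fml.neg φ)
  | and {φ ψ : Fml} : IsSigma0 φ → IsSigma0 ψ → IsSigma0 (Fml.and φ ψ)
  | or {φ ψ : Fml} : IsSigma0 φ → IsSigma0 ψ → IsSigma0 (Fml.or φ ψ)
  | allLe {x : NVar} {t : Tm} {φ : Fml} :
      ¬ t.HasN x → IsSigma0 φ → IsSigma0 (Fml.allLe x t φ)
  | exLe {x : NVar} {t : Tm} {φ : Fml} :
      ¬ t.HasN x → IsSigma0 φ → IsSigma0 (Fml.exLe x t φ)

mutual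

/-- `Σ^{1,b}_1`-formulas. -/
inductive IsSigma1 : Fml → Prop
  | base {φ : Fml} : IsSigma0 φ → IsSigma1 φ
  | neg {φ : Fml} : IsPi1 φ → IsSigma1 (Fml.neg φ)
  | and {φ ψ : Fml} : IsSigma1 φ → IsSigma1 ψ → IsSigma1 (Fml.and φ ψ)
  | or {φ ψ : Fml} : IsSigma1 φ → IsSigma1 ψ → IsSigma1 (Fml.or φ ψ)
  | exSLe {X : SVar} {t : Tm} {φ : Fml} :
      ¬ t.HasS X → IsSigma1 φ → IsSigma1 (Fml.exSLe X t φ)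

/-- `Π^{1,b}_1`-formulas. -/
inductive IsPi1 : Fml → Prop
  | base {φ : Fml} : IsSigma0 φ → IsPi1 φ
  | neg {φ : Fml} : IsSigma1 φ → IsPi1 (Fml.neg φ)
  | and {φ ψ : Fml} : IsPi1 φ → IsPi1 ψ → IsPi1 (Fml.and φ ψ)
  | or {φ ψ : Fml} : IsPi1 φ → IsPi1 ψ → IsPi1 (Fml.or φ ψ)
  | allSLe {X : SVar} {t : Tm} {φ : Fml} :
      ¬ t.HasS X → IsPi1 φ → IsPi1 (Fml.allSLe X t φ)

end

/-! ### The theory `V¹` -/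

/-- The axioms of `V¹`: 2-BASIC, comprehension for `Σ^{1,b}_0`-formulas and number induction for
`Σ^{1,b}_1`-formulas. Free variables are understood as universally quantified. -/
inductive V1 : Fml → Prop
  | b1 (x : NVar) : V1 (Fml.neg ((x : Tm) + 1 ≐ 0))
  | b2 (x y : NVar) : V1 ((x : Tm) + 1 ≐ y + 1 ⟹ x ≐ y)
  | b3 (x : NVar) : V1 ((x : Tm) + 0 ≐ x)
  | b4 (x y : NVar) : V1 ((x : Tm) + (y + 1) ≐ (x + y) + 1)
  | b5 (x : NVar) : V1 ((x : Tm) * 0 ≐ 0)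
  | b6 (x y : NVar) : V1 ((x : Tm) * (y + 1) ≐ x * y + x)
  | b7 (x y : NVar) : V1 ((x : Tm) ≤ₙ y ⩓ (y : Tm) ≤ₙ x ⟹ x ≐ y)
  | b8 (x y : NVar) : V1 ((x : Tm) ≤ₙ x + y)
  | b9 (x : NVar) : V1 (0 ≤ₙ (x : Tm))
  | b10 (x y : NVar) : V1 ((x : Tm) ≤ₙ y ⩔ (y : Tm) ≤ₙ x)
  | b11 (x y : NVar) : V1 ((x : Tm) ≤ₙ y ⟺ x <ₙ y + 1)
  | b12 (x y : NVar) : y ≠ x →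
      V1 (Fml.neg ((x : Tm) ≐ 0) ⟹ Fml.exLe y x ((y : Tm) + 1 ≐ x))
  | l1 (X : SVar) (y : NVar) : V1 ((y : Tm) ∊ X ⟹ y <ₙ Tm.len X)
  | l2 (X : SVar) (y : NVar) : V1 ((y : Tm) + 1 ≐ Tm.len X ⟹ y ∊ X)
  | se (X Y : SVar) (i : NVar) :
      V1 (Tm.len X ≐ Tm.len Y ⩓ Fml.allLt i (Tm.len X) ((i : Tm) ∊ X ⟺ i ∊ Y) ⟺ Fml.eqS X Y)
  | comp (φ : Fml) (x y : NVar) (X : SVar) : IsSigma0 φ → y ≠ x → ¬ φ.FreeS X →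
      V1 (Fml.exSLe X x (Fml.allLt y x ((y : Tm) ∊ X ⟺ φ)))
  | ind (φ : Fml) (x : NVar) : IsSigma1 φ →
      V1 (Fml.subst x 0 φ ⩓ Fml.allN x (φ ⟹ Fml.subst x (x + 1) φ) ⟹ Fml.allN x φ)

/-! ### Structures and provability -/

/-- Two-sorted structures. Both equality symbols are interpreted by equality. -/
structure Str where
  Num : Type
  Sets : Type
  sets_nonempty : Nonempty Sets
  zero : Num
  one : Num
  add : Num → Num → Num
  mul : Num → Num → Num
  len : Sets → Num
  le : Num → Num → Prop
  mem : Num → Sets → Prop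

/-- Value of a term under an assignment. -/
def Tm.val (M : Str) (v : NVar → M.Num) (w : SVar → M.Sets) : Tm → M.Num
  | var x => v x
  | zero => M.zero
  | one => M.one
  | add s t => M.add (s.val M v w) (t.val M v w)
  | mul s t => M.mul (s.val M v w) (t.val M v w)
  | len X => M.len (w X)

/-- Satisfaction of a formula under an assignment. -/
def Fml.Sat (M : Str) : Fml → (NVar → M.Num) → (SVar → M.Sets) → Prop
  | eqN s t, v, w => s.val M v w = t.val M v w
  | eqS X Y, _, w => w X = w Y
  | le s t, v, w => M.le (s.val M v w) (t.val M v w)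
  | mem t X, v, w => M.mem (t.val M v w) (w X)
  | neg φ, v, w => ¬ φ.Sat M v w
  | and φ ψ, v, w => φ.Sat M v w ∧ ψ.Sat M v w
  | or φ ψ, v, w => φ.Sat M v w ∨ ψ.Sat M v w
  | allN x φ, v, w => ∀ a : M.Num, φ.Sat M (Function.update v x a) w
  | exN x φ, v, w => ∃ a : M.Num, φ.Sat M (Function.update v x a) w
  | allS X φ, v, w => ∀ A : M.Sets, φ.Sat M v (Function.update w X A)
  | exS X φ, v, w => ∃ A : M.Sets, φ.Sat M v (Function.update w X A)

/-- The universal closure of `φ` holds in `M`. -/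
def Str.Models (M : Str) (φ : Fml) : Prop := ∀ v w, φ.Sat M v w

/-- `φ` is a theorem of the theory axiomatized by `T`. As usual a theory is the closure of its
axioms under first-order logical consequence, i.e. `φ` holds in all (in general nonstandard)
two-sorted structures in which the axioms hold. By the completeness theorem this is derivability;
the language is countable, so structures with carriers in `Type` suffice. -/
def Proves (T : Fml → Prop) (φ : Fml) : Prop :=
  ∀ M : Str, (∀ ψ, T ψ → M.Models ψ) → M.Models φ

/-! ### Tuples -/

/-- The pairing function `⟨x, y⟩ = (x + y)(x + y + 1) + 2y`, which is a term of the language (it is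
twice the Cantor pairing function, for which one would have to divide by two). -/
def Tm.pair (s t : Tm) : Tm := (s + t) * (s + t + 1) + (t + t)

notation "⟪" s ", " t "⟫" => Tm.pair s t

/-- Tuples `⟨x₁, …, x_k⟩ = ⟨…⟨⟨x₁, x₂⟩, x₃⟩, …, x_k⟩`. -/
def Tm.tuple : List Tm → Tm
  | [] => 0
  | t :: ts => ts.foldl Tm.pair t

/-- Conjunction of a list of formulas. -/
def Fml.conj : List Fml → Fml
  | [] => (0 : Tm) ≐ 0
  | φ :: φs => φ ⩓ Fml.conj φs

/-! ### Names of variables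

All bound variables of the formulas below have pairwise different names, so that no variable is
captured when one formula is used inside another. -/

namespace Names

/-- size of the universe `{0, …, l - 1}` of the algebra -/
def l : NVar := ⟨0⟩
/-- number of variables of the instance -/
def n : NVar := ⟨1⟩
/-- number of reduction steps -/
def s : NVar := ⟨2⟩
/-- index of a reduction step -/
def r : NVar := ⟨3⟩
/-- the variable of the instance at which the reduction step starts -/
def i : NVar := ⟨4⟩
/-- the variable of the instance whose domain is reduced -/
def j : NVar := ⟨5⟩

def p₁ : NVar := ⟨10⟩
def p₂ : NVar := ⟨11⟩
def q₁ : NVar := ⟨12⟩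
def q₂ : NVar := ⟨13⟩
def q₃ : NVar := ⟨14⟩

def c₁ : NVar := ⟨20⟩
def c₂ : NVar := ⟨21⟩
def c₃ : NVar := ⟨22⟩
def y₁ : NVar := ⟨23⟩
def y₂ : NVar := ⟨24⟩
def d₁ : NVar := ⟨25⟩
def d₂ : NVar := ⟨26⟩

def t : NVar := ⟨30⟩
def k : NVar := ⟨31⟩
def a : NVar := ⟨32⟩
def b : NVar := ⟨33⟩
def j' : NVar := ⟨34⟩
def a' : NVar := ⟨35⟩
def b' : NVar := ⟨36⟩
def c : NVar := ⟨37⟩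
def d : NVar := ⟨38⟩
def e : NVar := ⟨39⟩

def u : NVar := ⟨40⟩
def v : NVar := ⟨41⟩
def f : NVar := ⟨42⟩
def g : NVar := ⟨43⟩
def f' : NVar := ⟨44⟩
def g' : NVar := ⟨45⟩

/-- two disjoint families of names for the arguments of the basic operation -/
def x₁ (h : ℕ) : NVar := ⟨100 + 2 * h⟩
def x₂ (h : ℕ) : NVar := ⟨101 + 2 * h⟩

/-- the basic operation -/
def Ω : SVar := ⟨0⟩
/-- vertices and edges of the input digraph -/
def VX : SVar := ⟨1⟩
def EX : SVar := ⟨2⟩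
/-- vertices and edges of the given target digraph with domains -/
def VA : SVar := ⟨3⟩
def EA : SVar := ⟨4⟩
/-- vertices and edges of the reduced target digraph with domains -/
def Vir : SVar := ⟨5⟩
def Eir : SVar := ⟨6⟩
/-- vertices and edges of all stages of the reduction -/
def VW : SVar := ⟨7⟩
def EW : SVar := ⟨8⟩

def σ : SVar := ⟨10⟩
def σ' : SVar := ⟨11⟩
def I : SVar := ⟨12⟩
/-- vertices and edges of the subgraph of the input digraph -/
def VX' : SVar := ⟨13⟩
def EX' : SVar := ⟨14⟩
def H : SVar := ⟨15⟩

end Names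

open Names

/-! ### Congruences

A subset `D` of `{0, …, l - 1}` is given by the formula `D x` expressing `x ∈ D`. -/

/-- `∀ x ∈ D, φ` and `∃ x ∈ D, φ`. -/
def allIn (D : Tm → Fml) (x : NVar) (φ : Fml) : Fml := Fml.allLt x l (D x ⟹ φ)
def exIn (D : Tm → Fml) (x : NVar) (φ : Fml) : Fml := Fml.exLt x l (D x ⩓ φ)

/-- `∀ x ∈ D` for all variables of a list. -/
def allInList (D : Tm → Fml) (xs : List NVar) (φ : Fml) : Fml := xs.foldr (allIn D) φ

/-- The names `x₁ 0, …, x₁ (m - 1)`, and the same for `x₂`. -/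
def args₁ (m : ℕ) : List NVar := (List.range m).map x₁
def args₂ (m : ℕ) : List NVar := (List.range m).map x₂

/-- `Ω(x₀, …, x_{m-1}) = y`. -/
def app (xs : List NVar) (y : NVar) : Fml := Tm.tuple (xs.map Tm.var ++ [(y : Tm)]) ∊ Ω

/-- `Ω` is an `m`-ary operation on `D`. -/
def fOP (m : ℕ) (D : Tm → Fml) : Fml :=
  allInList D (args₁ m) (exIn D y₁ (app (args₁ m) y₁) ⩓
    allIn D y₁ (allIn D y₂ (app (args₁ m) y₁ ⩓ app (args₁ m) y₂ ⟹ y₁ ≐ y₂)))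

/-- `Ω` is an `m`-ary operation on `D` and preserves the binary relation `R`. -/
def fPol (m : ℕ) (D : Tm → Fml) (R : SVar) : Fml :=
  fOP m D ⩓ allInList D (args₁ m) (allInList D (args₂ m) (allIn D y₁ (allIn D y₂
    (Fml.conj ((List.range m).map fun h => ⟪x₁ h, x₂ h⟫ ∊ R) ⩓
      app (args₁ m) y₁ ⩓ app (args₂ m) y₂ ⟹ ⟪y₁, y₂⟫ ∊ R))))

/-- `R` is a congruence on `(D, Ω)`. -/
def fCong (m : ℕ) (D : Tm → Fml) (R : SVar) : Fml :=
  fPol m D R ⩓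
  allIn D c₁ (⟪c₁, c₁⟫ ∊ R) ⩓
  allIn D c₁ (allIn D c₂ (⟪c₁, c₂⟫ ∊ R ⟺ ⟪c₂, c₁⟫ ∊ R)) ⩓
  allIn D c₁ (allIn D c₂ (allIn D c₃ (⟪c₁, c₂⟫ ∊ R ⩓ ⟪c₂, c₃⟫ ∊ R ⟹ ⟪c₁, c₃⟫ ∊ R)))

/-- `R` is not the full relation on `D`. -/
def fNotFull (D : Tm → Fml) (R : SVar) : Fml :=
  exIn D d₁ (exIn D d₂ (Fml.neg (⟪d₁, d₂⟫ ∊ R)))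

/-- `R ∩ D² ⊆ R'`. -/
def fSub (D : Tm → Fml) (R R' : SVar) : Fml :=
  allIn D d₁ (allIn D d₂ (⟪d₁, d₂⟫ ∊ R ⟹ ⟪d₁, d₂⟫ ∊ R'))

/-- `σ` is a maximal congruence on `(D, Ω)`: it is not full, and no congruence that is not full
is strictly larger. -/
def fMCong (m : ℕ) (D : Tm → Fml) : Fml :=
  fCong m D σ ⩓ fNotFull D σ ⩓
  Fml.allSLt σ' ⟪l, l⟫ (fCong m D σ' ⩓ fNotFull D σ' ⩓ fSub D σ σ' ⟹ fSub D σ' σ)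

/-! ### Instances and homomorphisms -/

/-- A target digraph with domains, given by the formulas `V u` and `E u v` for its vertices and
edges; the vertex `⟨i, a⟩` is the element `a` of the domain `D_i`. -/
structure Target where
  V : Tm → Fml
  E : Tm → Tm → Fml

/-- `a ∈ D_i`. -/
def Target.dom (T : Target) (i a : Tm) : Fml := T.V ⟪i, a⟫

/-- The relation `E^{ij}(a, b)`. -/
def Target.rel (T : Target) (i j a b : Tm) : Fml := T.E ⟪i, a⟫ ⟪j, b⟫

/-- The target digraph coded by a set of vertices and a set of (codes of) edges. -/
def target (V E : SVar) : Target := ⟨fun u => u ∊ V, fun u v => ⟪u, v⟫ ∊ E⟩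

/-- The target digraph that is stage `x` of the sequence coded by `VW`, `EW`. -/
def stage (x : Tm) : Target := ⟨fun u => ⟪x, u⟫ ∊ VW, fun u v => Tm.tuple [x, u, v] ∊ EW⟩

/-- `((VX, EX), (VA, EA))` is an instance: `VX = {0, …, n - 1}`, `EX` is a binary relation on it,
and `(VA, EA)` is a target digraph with domains `D_0, …, D_{n-1} ⊆ {0, …, l - 1}`. -/
def fDG : Fml :=
  (Tm.len VX ≐ n) ⩓ Fml.allLt f n ((f : Tm) ∊ VX) ⩓
  Fml.allLt u (Tm.len EX) ((u : Tm) ∊ EX ⟹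
    Fml.exLt f n (Fml.exLt g n (u ≐ ⟪f, g⟫))) ⩓
  (Tm.len VA <ₙ ⟪n, l⟫) ⩓
  Fml.allLt u (Tm.len VA) ((u : Tm) ∊ VA ⟹
    Fml.exLt f n (Fml.exLt g l (u ≐ ⟪f, g⟫))) ⩓
  (Tm.len EA <ₙ ⟪⟪n, l⟫, ⟪n, l⟫⟫) ⩓
  Fml.allLt u ⟪n, l⟫ (Fml.allLt v ⟪n, l⟫ (⟪u, v⟫ ∊ EA ⟹
    Fml.exLt f n (Fml.exLt f' n (Fml.exLt g l (Fml.exLt g' l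
      (u ≐ ⟪f, g⟫ ⩓ v ≐ ⟪f', g'⟫ ⩓ (target VA EA).dom f g ⩓ (target VA EA).dom f' g'))))))

/-- `H` is a homomorphism from the digraph `(V, E)`, `V ⊆ {0, …, n - 1}`, to the target digraph `T`
which sends each `i ∈ V` into the domain `D_i`; `H(i) = u` is coded by `⟨i, u⟩ ∈ H`. -/
def fHom (V E : SVar) (T : Target) : Fml :=
  Fml.allLt p₁ n ((p₁ : Tm) ∊ V ⟹ Fml.exLt q₁ ⟪n, l⟫ (T.V q₁ ⩓ ⟪p₁, q₁⟫ ∊ H)) ⩓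
  Fml.allLt p₁ n ((p₁ : Tm) ∊ V ⟹ Fml.allLt q₁ ⟪n, l⟫ (Fml.allLt q₂ ⟪n, l⟫
    (T.V q₁ ⩓ T.V q₂ ⩓ ⟪p₁, q₁⟫ ∊ H ⩓ ⟪p₁, q₂⟫ ∊ H ⟹ q₁ ≐ q₂))) ⩓
  Fml.allLt p₁ n (Fml.allLt q₁ ⟪n, l⟫ (⟪p₁, q₁⟫ ∊ H ⟹
    Fml.exLt q₃ l (q₁ ≐ ⟪p₁, q₃⟫ ⩓ T.dom p₁ q₃))) ⩓
  Fml.allLt p₁ n (Fml.allLt p₂ n (Fml.allLt q₁ ⟪n, l⟫ (Fml.allLt q₂ ⟪n, l⟫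
    (⟪p₁, p₂⟫ ∊ E ⩓ ⟪p₁, q₁⟫ ∊ H ⩓ ⟪p₂, q₂⟫ ∊ H ⟹ T.E q₁ q₂))))

/-- The instance `((V, E), T)` has a solution. -/
def fSolvable (V E : SVar) (T : Target) : Fml :=
  Fml.exSLt H ⟪n, ⟪n, l⟫⟫ (fHom V E T)

/-- The instance `((V, E), T)` has a solution that sends `x` to `a`. -/
def fSolvableAt (V E : SVar) (T : Target) (x a : Tm) : Fml :=
  Fml.exSLt H ⟪n, ⟪n, l⟫⟫ (fHom V E T ⩓ ⟪x, ⟪x, a⟫⟫ ∊ H)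

/-! ### The irreducibility reduction -/

/-- `E_X(x, y)` and `E^{xy}(a, b)`, or `E_X(y, x)` and `E^{yx}(b, a)`, for both of the pairs
`(a₁, b₁)` and `(a₂, b₂)`. -/
def fJoined (T : Target) (x y a₁ b₁ a₂ b₂ : Tm) : Fml :=
  (⟪x, y⟫ ∊ EX ⩓ T.rel x y a₁ b₁ ⩓ T.rel x y a₂ b₂) ⩔
  (⟪y, x⟫ ∊ EX ⩓ T.rel y x b₁ a₁ ⩓ T.rel y x b₂ a₂)

/-- `I` codes the relations `I_0, …, I_n` generated by the congruence `σ` on the domain `D_i`: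
`I_0(k, a, b)` iff `k = i` and `a, b ∈ D_i` are congruent, and `I_{t+1}(k, a, b)` iff
`I_t(k, a, b)` or for some `j'` there are `a', b'` with `I_t(j', a', b')` such that `(a', a)` and
`(b', b)` are in the constraint between `j'` and `k`, while no two elements `c, d` of `D_{j'}` with
`¬ I_t(j', c, d)` are joined by this constraint to one element `e` of `D_k`. -/
def fGenerated (T : Target) : Fml :=
  Fml.allLt k n (Fml.allLt a l (Fml.allLt b l
    (Tm.tuple [0, k, a, b] ∊ I ⟺
      k ≐ i ⩓ T.dom i a ⩓ T.dom i b ⩓ ⟪a, b⟫ ∊ σ))) ⩓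
  Fml.allLt t n (Fml.allLt k n (Fml.allLt a l (Fml.allLt b l
    (Tm.tuple [t + 1, k, a, b] ∊ I ⟺
      Tm.tuple [t, k, a, b] ∊ I ⩔
      Fml.exLt j' n (Fml.exLt a' l (Fml.exLt b' l
        (Tm.tuple [t, j', a', b'] ∊ I ⩓
          fJoined T j' k a' a b' b ⩓
          Fml.neg (Fml.exLt c l (Fml.exLt d l (Fml.exLt e l
            (T.dom j' c ⩓ T.dom j' d ⩓ T.dom k e ⩓
              Fml.neg (Tm.tuple [t, j', c, d] ∊ I) ⩓
              fJoined T j' k c e d e)))))))))))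

/-- `(VX', EX')` is the subgraph of `(VX, EX)` induced on the set of all `k` such that
`I_n(k, a, b)` for some `a, b`. -/
def fInduced : Fml :=
  (Tm.len VX' ≤ₙ n) ⩓
  Fml.allLt k n ((k : Tm) ∊ VX' ⟺
    Fml.exLt a l (Fml.exLt b l (Tm.tuple [(n : Tm), k, a, b] ∊ I))) ⩓
  Fml.allLt u (Tm.len EX') ((u : Tm) ∊ EX' ⟹
    Fml.exLt f n (Fml.exLt g n (u ≐ ⟪f, g⟫))) ⩓
  Fml.allLt f n (Fml.allLt g n
    (⟪f, g⟫ ∊ EX' ⟺ (f : Tm) ∊ VX' ⩓ (g : Tm) ∊ VX' ⩓ ⟪f, g⟫ ∊ EX))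

/-- `T'` arises from `T` by removing from the domain `D_j` all elements `a` such that no solution of
the instance `((VX', EX'), T)` sends `j` to `a`, together with the edges at these elements. -/
def fRemoved (T T' : Target) : Fml :=
  Fml.allLt u ⟪n, l⟫ (T'.V u ⟹ T.V u) ⩓
  Fml.allLt k n (Fml.allLt a l (T'.dom k a ⟺
    T.dom k a ⩓ (k ≐ j ⟹ fSolvableAt VX' EX' T j a))) ⩓
  Fml.allLt u ⟪n, l⟫ (Fml.allLt v ⟪n, l⟫ (T'.E u v ⟺ T.E u v ⩓ T'.V u ⩓ T'.V v))

/-- `T'` arises from `T` by one irreducibility reduction: there are a variable `i`, a maximal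
congruence `σ` on its domain, the induced subgraph on the variables to which `σ` spreads, and a
variable `j` in it, whose domain is reduced. -/
def fReduction (m : ℕ) (T T' : Target) : Fml :=
  Fml.exLt i n (Fml.exLt j n (Fml.exSLt σ ⟪l, l⟫ (Fml.exS I (Fml.exS VX' (Fml.exS EX'
    (fMCong m (T.dom i) ⩓ fGenerated T ⩓ fInduced ⩓ (j : Tm) ∊ VX' ⩓ fRemoved T T'))))))

/-- `T` and `T'` have the same vertices and edges. -/
def fSame (T T' : Target) : Fml :=
  Fml.allLt u ⟪n, l⟫ (T.V u ⟺ T'.V u) ⩓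
  Fml.allLt u ⟪n, l⟫ (Fml.allLt v ⟪n, l⟫ (T.E u v ⟺ T'.E u v))

/-- `(Vir, Eir)` is the result of the irreducibility reduction of `(VA, EA)`: `VW, EW` code a
sequence of target digraphs that starts with `(VA, EA)` and ends with `(Vir, Eir)`, and each of
them arises from the previous one by one irreducibility reduction. It is not required that no
further reduction is possible at the end, so every run of the procedure is covered. -/
def fRun (m : ℕ) : Fml :=
  fSame (stage 0) (target VA EA) ⩓
  Fml.allLt r s (fReduction m (stage r) (stage (r + 1))) ⩓
  fSame (stage s) (target Vir Eir)

/-- If `Θ = ((VX, EX), (VA, EA))` has a solution and `Θ_ir = ((VX, EX), (Vir, Eir))` results from it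
by the irreducibility reduction, then `Θ_ir` has a solution. -/
def irreducibilitySoundness (m : ℕ) : Fml :=
  Fml.allN l (Fml.allN n (Fml.allN s (Fml.allS Ω (Fml.allS VX (Fml.allS EX (Fml.allS VA (Fml.allS EA
    (Fml.allS Vir (Fml.allS Eir (Fml.allS VW (Fml.allS EW
      (fDG ⩓ fRun m ⟹ fSolvable VX EX (target VA EA) ⟹
        fSolvable VX EX (target Vir Eir)))))))))))))

end BoundedArith

-- One fixed solution `h` of the original instance survives every reduction. A step removes `a` from
-- `D_j` only if no solution of the subinstance on `VX'` sends `j` to `a`. The edges of the subgraph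
-- are edges of the whole digraph, so `h` also solves the subinstance, and therefore its value at
-- `j` is kept. An edge is lost only together with one of its ends, so `h` remains a homomorphism
-- (`isHom_of_fReduction`).
--
-- The stages are then treated by number induction (`IsStageHom.last`). Since the set `h` is the
-- same throughout, it enters the induction formula as a parameter. The formula is thus `Σ^{1,b}_0`
-- (`isSigma0_fHom`), and no set has to be constructed along the way. The argument takes place in an
-- arbitrary model of the axioms, after satisfaction of `fHom` has been translated into the semantic
-- predicate `IsHom` (`sat_fHom`).

namespace BoundedArith

open Names

-- Homomorphisms inside a structure.

namespace Str

/-- The strict order of a structure. -/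
def lt (M : Str) (x y : M.Num) : Prop := M.le x y ∧ x ≠ y

/-- The value of the pairing term. -/
def pair (M : Str) (x y : M.Num) : M.Num :=
  M.add (M.mul (M.add x y) (M.add (M.add x y) M.one)) (M.add y y)

/-- `H` is a homomorphism from the digraph `(V, E)`, `V ⊆ {0, …, n - 1}`, to the target digraph with
vertices `TV` and edges `TE`, which sends `i ∈ V` into the domain `D_i ⊆ {0, …, l - 1}`. -/
structure IsHom (M : Str) (n l : M.Num) (V E H : M.Sets) (TV : M.Num → Prop)
    (TE : M.Num → M.Num → Prop) : Prop where
  total : ∀ p, M.lt p n → M.mem p V → ∃ q, M.lt q (M.pair n l) ∧ TV q ∧ M.mem (M.pair p q) H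
  unique : ∀ p, M.lt p n → M.mem p V → ∀ q, M.lt q (M.pair n l) → ∀ q', M.lt q' (M.pair n l) →
    TV q → TV q' → M.mem (M.pair p q) H → M.mem (M.pair p q') H → q = q'
  dom : ∀ p, M.lt p n → ∀ q, M.lt q (M.pair n l) → M.mem (M.pair p q) H →
    ∃ a, M.lt a l ∧ q = M.pair p a ∧ TV (M.pair p a)
  edge : ∀ p, M.lt p n → ∀ p', M.lt p' n → ∀ q, M.lt q (M.pair n l) →
    ∀ q', M.lt q' (M.pair n l) → M.mem (M.pair p p') E → M.mem (M.pair p q) H →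
    M.mem (M.pair p' q') H → TE q q'

variable {M : Str} {n l : M.Num} {V E V' E' H : M.Sets} {TV TV' : M.Num → Prop}
  {TE TE' : M.Num → M.Num → Prop}

/-- This passes between a coded target and the first or last stage of a run. Agreement below `⟨n,
l⟩` is enough, since every value considered is bounded by it. -/
theorem IsHom.congr (h : M.IsHom n l V E H TV TE)
    (hV : ∀ q, M.lt q (M.pair n l) → (TV q ↔ TV' q))
    (hE : ∀ q, M.lt q (M.pair n l) → ∀ q', M.lt q' (M.pair n l) → (TE q q' ↔ TE' q q')) :
    M.IsHom n l V E H TV' TE' where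
  total p hp hpV := by
    obtain ⟨q, hq, hqV, hpq⟩ := h.total p hp hpV
    exact ⟨q, hq, (hV q hq).1 hqV, hpq⟩
  unique p hp hpV q hq q' hq' hqV hqV' :=
    h.unique p hp hpV q hq q' hq' ((hV q hq).2 hqV) ((hV q' hq').2 hqV')
  dom p hp q hq hpq := by
    obtain ⟨a, ha, rfl, haV⟩ := h.dom p hp q hq hpq
    exact ⟨a, ha, rfl, (hV _ hq).1 haV⟩
  edge p hp p' hp' q hq q' hq' he h1 h2 :=
    (hE q hq q' hq').1 (h.edge p hp p' hp' q hq q' hq' he h1 h2)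

/-- The clause `dom` ranges over all `p < n` and not only over `V`, so the code `H` itself serves
for the subgraph and need not be cut down. -/
theorem IsHom.restrict (h : M.IsHom n l V E H TV TE)
    (hV : ∀ p, M.lt p n → M.mem p V' → M.mem p V)
    (hE : ∀ p, M.lt p n → ∀ p', M.lt p' n → M.mem (M.pair p p') E' → M.mem (M.pair p p') E) :
    M.IsHom n l V' E' H TV TE where
  total p hp hpV := h.total p hp (hV p hp hpV)
  unique p hp hpV := h.unique p hp (hV p hp hpV)
  dom := h.dom
  edge p hp p' hp' q hq q' hq' he := h.edge p hp p' hp' q hq q' hq' (hE p hp p' hp' he)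

/-- A homomorphism survives the removal of vertices that are not among its values. -/
theorem IsHom.shrink (h : M.IsHom n l V E H TV TE)
    (hsub : ∀ q, M.lt q (M.pair n l) → TV' q → TV q)
    (hdom : ∀ p, M.lt p n → ∀ a, M.lt a l → M.mem (M.pair p (M.pair p a)) H →
      TV (M.pair p a) → TV' (M.pair p a))
    (hE : ∀ q, M.lt q (M.pair n l) → ∀ q', M.lt q' (M.pair n l) →
      TE q q' → TV' q → TV' q' → TE' q q') :
    M.IsHom n l V E H TV' TE' := by
  -- By `dom` every value of `H` is a pair `⟨p, a⟩`, so `hdom`, which speaks only of such pairs,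
  -- covers all values.
  have key : ∀ p, M.lt p n → ∀ q, M.lt q (M.pair n l) → M.mem (M.pair p q) H →
      ∃ a, M.lt a l ∧ q = M.pair p a ∧ TV' (M.pair p a) := by
    intro p hp q hq hpq
    obtain ⟨a, ha, rfl, haV⟩ := h.dom p hp q hq hpq
    exact ⟨a, ha, rfl, hdom p hp a ha hpq haV⟩
  have key' : ∀ p, M.lt p n → ∀ q, M.lt q (M.pair n l) → M.mem (M.pair p q) H → TV' q := by
    intro p hp q hq hpq
    obtain ⟨a, -, rfl, haV⟩ := key p hp q hq hpq
    exact haV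
  refine ⟨fun p hp hpV => ?_, fun p hp hpV q hq q' hq' hqV hqV' => ?_, key,
    fun p hp p' hp' q hq q' hq' he h1 h2 => ?_⟩
  · obtain ⟨q, hq, -, hpq⟩ := h.total p hp hpV
    exact ⟨q, hq, key' p hp q hq hpq, hpq⟩
  · exact h.unique p hp hpV q hq q' hq' (hsub q hq hqV) (hsub q' hq' hqV')
  · exact hE q hq q' hq' (h.edge p hp p' hp' q hq q' hq' he h1 h2) (key' p hp q hq h1)
      (key' p' hp' q' hq' h2)

end Str

-- Satisfaction of the derived connectives and bounded quantifiers.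

section Sat

variable {M : Str} {v : NVar → M.Num} {w : SVar → M.Sets}

theorem sat_imp {φ ψ : Fml} : (φ ⟹ ψ).Sat M v w ↔ (φ.Sat M v w → ψ.Sat M v w) := by
  simp only [Fml.imp, Fml.Sat]; tauto

theorem sat_iff {φ ψ : Fml} : (φ ⟺ ψ).Sat M v w ↔ (φ.Sat M v w ↔ ψ.Sat M v w) := by
  simp only [Fml.iff, Fml.Sat, sat_imp]; tauto

theorem sat_lt {s t : Tm} : (s <ₙ t).Sat M v w ↔ M.lt (s.val M v w) (t.val M v w) := Iff.rfl

theorem Tm.val_update_of_not_hasN {x : NVar} {t : Tm} (h : ¬ t.HasN x) (a : M.Num) :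
    t.val M (Function.update v x a) w = t.val M v w := by
  induction t with
  | var y => exact Function.update_of_ne h _ _
  | zero => rfl
  | one => rfl
  | add s t hs ht =>
    simp only [Tm.HasN, not_or] at h
    simp only [Tm.val, hs h.1, ht h.2]
  | mul s t hs ht =>
    simp only [Tm.HasN, not_or] at h
    simp only [Tm.val, hs h.1, ht h.2]
  | len X => rfl

theorem Tm.val_update_of_not_hasS {X : SVar} {t : Tm} (h : ¬ t.HasS X) (A : M.Sets) :
    t.val M v (Function.update w X A) = t.val M v w := by
  induction t with
  | var y => rfl
  | zero => rfl
  | one => rfl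
  | add s t hs ht =>
    simp only [Tm.HasS, not_or] at h
    simp only [Tm.val, hs h.1, ht h.2]
  | mul s t hs ht =>
    simp only [Tm.HasS, not_or] at h
    simp only [Tm.val, hs h.1, ht h.2]
  | len Y => exact congrArg M.len (Function.update_of_ne h _ _)

/-- The bound `t` stands inside the scope of the quantifier; the side condition lets it be evaluated
outside. -/
theorem sat_allLt {x : NVar} {t : Tm} {φ : Fml} (h : ¬ t.HasN x) :
    (Fml.allLt x t φ).Sat M v w ↔
      ∀ a, M.lt a (t.val M v w) → φ.Sat M (Function.update v x a) w := by
  simp only [Fml.allLt, Fml.allLe, Fml.Sat, sat_imp, Tm.val_update_of_not_hasN h, Tm.val,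
    Function.update_self, Str.lt, and_imp, ne_eq]

theorem sat_exLt {x : NVar} {t : Tm} {φ : Fml} (h : ¬ t.HasN x) :
    (Fml.exLt x t φ).Sat M v w ↔
      ∃ a, M.lt a (t.val M v w) ∧ φ.Sat M (Function.update v x a) w := by
  simp only [Fml.exLt, Fml.exLe, Fml.Sat, Tm.val_update_of_not_hasN h, Tm.val,
    Function.update_self, Str.lt, and_assoc, ne_eq]

theorem sat_exSLt {X : SVar} {t : Tm} {φ : Fml} (h : ¬ t.HasS X) :
    (Fml.exSLt X t φ).Sat M v w ↔
      ∃ A, M.lt (M.len A) (t.val M v w) ∧ φ.Sat M v (Function.update w X A) := by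
  simp only [Fml.exSLt, Fml.exSLe, Fml.Sat, Tm.val_update_of_not_hasS h, Tm.val,
    Function.update_self, Str.lt, and_assoc, ne_eq]

theorem hasN_pair {x : NVar} {s t : Tm} : (⟪s, t⟫ : Tm).HasN x ↔ s.HasN x ∨ t.HasN x := by
  change (((_ ∨ _) ∨ (_ ∨ _) ∨ False) ∨ _ ∨ _) ↔ _
  tauto

theorem hasS_pair {X : SVar} {s t : Tm} : (⟪s, t⟫ : Tm).HasS X ↔ s.HasS X ∨ t.HasS X := by
  change (((_ ∨ _) ∨ (_ ∨ _) ∨ False) ∨ _ ∨ _) ↔ _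
  tauto

theorem val_pair {s t : Tm} : (⟪s, t⟫ : Tm).val M v w = M.pair (s.val M v w) (t.val M v w) := rfl

end Sat

-- The homomorphism property is `Σ^{1,b}_0`.

theorem IsSigma0.imp {φ ψ : Fml} (hφ : IsSigma0 φ) (hψ : IsSigma0 ψ) : IsSigma0 (φ ⟹ ψ) :=
  .or (.neg hφ) hψ

theorem IsSigma0.allLt {x : NVar} {t : Tm} {φ : Fml} (h : ¬ t.HasN x) (hφ : IsSigma0 φ) :
    IsSigma0 (Fml.allLt x t φ) := .allLe h (.imp (.neg (.eqN _ _)) hφ)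

theorem IsSigma0.exLt {x : NVar} {t : Tm} {φ : Fml} (h : ¬ t.HasN x) (hφ : IsSigma0 φ) :
    IsSigma0 (Fml.exLt x t φ) := .exLe h (.and (.neg (.eqN _ _)) hφ)

/-- `H` is free in `fHom` and all quantifiers are bounded number quantifiers. This makes induction
on the stage available. -/
theorem isSigma0_fHom {V E : SVar} {T : Target} (hV : ∀ u, IsSigma0 (T.V u))
    (hE : ∀ u v, IsSigma0 (T.E u v)) : IsSigma0 (fHom V E T) := by
  unfold fHom Target.dom
  repeat' first
    | exact hV _ | exact hE _ _ | apply IsSigma0.allLt | apply IsSigma0.exLt | apply IsSigma0.imp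
    | apply IsSigma0.and | exact IsSigma0.mem _ _ | exact IsSigma0.eqN _ _
    | simp [Tm.HasN, Tm.pair, n, l, p₁, p₂, q₁, q₂, q₃, HAdd.hAdd, HMul.hMul, Add.add, Mul.mul,
        OfNat.ofNat, One.one]

-- Evaluating targets and reductions under changing assignments.

/-- The second assignment differs from the first one only at names that are bound in reductions. -/
def Agree {M : Str} (v : NVar → M.Num) (w : SVar → M.Sets) (v' : NVar → M.Num)
    (w' : SVar → M.Sets) : Prop :=
  (∀ x : NVar, x.idx < 4 → v' x = v x) ∧ ∀ X : SVar, X.idx < 9 → w' X = w X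

section Agree

variable {M : Str} {v v' v'' : NVar → M.Num} {w w' w'' : SVar → M.Sets}

theorem Agree.refl : Agree v w v w := ⟨fun _ _ => rfl, fun _ _ => rfl⟩

theorem Agree.trans (h : Agree v w v' w') (h' : Agree v' w' v'' w'') : Agree v w v'' w'' :=
  ⟨fun x hx => (h'.1 x hx).trans (h.1 x hx), fun X hX => (h'.2 X hX).trans (h.2 X hX)⟩

/-- The thresholds separate the parameters from the bound names: `l`, `n`, `s`, `r` have indices 0
to 3 and `Ω`, …, `EW` indices 0 to 8, while everything quantified inside a reduction comes later. -/
theorem Agree.updateN {x : NVar} {a : M.Num} (h : Agree v w v' w') (hx : 4 ≤ x.idx) :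
    Agree v w (Function.update v' x a) w' :=
  ⟨fun y hy => (Function.update_of_ne (by rintro rfl; omega) _ _).trans (h.1 y hy), h.2⟩

theorem Agree.updateS {X : SVar} {A : M.Sets} (h : Agree v w v' w') (hX : 9 ≤ X.idx) :
    Agree v w v' (Function.update w' X A) :=
  ⟨h.1, fun Y hY => (Function.update_of_ne (by rintro rfl; omega) _ _).trans (h.2 Y hY)⟩

/-- The target `T` has vertices `TV` and edges `TE`, whatever the values of bound names. -/
structure Target.Realizes (T : Target) (v : NVar → M.Num) (w : SVar → M.Sets)
    (TV : M.Num → Prop) (TE : M.Num → M.Num → Prop) : Prop where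
  vert : ∀ {v' w'}, Agree v w v' w' → ∀ u, (T.V u).Sat M v' w' ↔ TV (u.val M v' w')
  edge : ∀ {v' w'}, Agree v w v' w' → ∀ u u',
    (T.E u u').Sat M v' w' ↔ TE (u.val M v' w') (u'.val M v' w')

variable {T T' : Target} {TV TV' : M.Num → Prop} {TE TE' : M.Num → M.Num → Prop}

theorem Target.Realizes.of_agree (hT : T.Realizes v w TV TE) (h : Agree v w v' w') :
    T.Realizes v' w' TV TE :=
  ⟨fun h' => hT.vert (h.trans h'), fun h' => hT.edge (h.trans h')⟩

theorem target_realizes {V E : SVar} (hV : V.idx < 9) (hE : E.idx < 9) :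
    (target V E).Realizes v w (fun u => M.mem u (w V)) fun u u' => M.mem (M.pair u u') (w E) where
  vert h u := by rw [← h.2 V hV]; rfl
  edge h u u' := by rw [← h.2 E hE]; rfl

/-- The term `x` will be `0`, `r`, `r + 1` or `s`, whose values no binder inside a reduction
changes. Tuples associate to the left, hence the nesting of the pairs. -/
theorem stage_realizes {x : Tm} {z : M.Num} (hx : ∀ {v' w'}, Agree v w v' w' → x.val M v' w' = z) :
    (stage x).Realizes v w (fun u => M.mem (M.pair z u) (w VW))
      fun u u' => M.mem (M.pair (M.pair z u) u') (w EW) where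
  vert h u := by rw [← h.2 VW (by decide), ← hx h]; rfl
  edge h u u' := by rw [← h.2 EW (by decide), ← hx h]; rfl

theorem sat_fHom {V E : SVar} (hT : T.Realizes v w TV TE) :
    (fHom V E T).Sat M v w ↔ M.IsHom (v n) (v l) (w V) (w E) (w H) TV TE := by
  have hV := @hT.vert
  have hE := @hT.edge
  simp (decide := true) (maxDischargeDepth := 10) only [fHom, Target.dom, Fml.Sat, sat_allLt,
    sat_exLt, sat_imp, val_pair, hV, hE, Agree.refl, Agree.updateN, hasN_pair, Tm.HasN, Tm.val,
    Function.update_self, Function.update_of_ne, ne_eq, not_false_eq_true, or_self, and_imp]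
  exact ⟨fun h => ⟨h.1, h.2.1, h.2.2.1, h.2.2.2⟩, fun h => ⟨h.1, h.2, h.3, h.4⟩⟩

theorem sat_fSame (hT : T.Realizes v w TV TE) (hT' : T'.Realizes v w TV' TE') :
    (fSame T T').Sat M v w ↔
      (∀ q, M.lt q (M.pair (v n) (v l)) → (TV q ↔ TV' q)) ∧
      ∀ q, M.lt q (M.pair (v n) (v l)) → ∀ q', M.lt q' (M.pair (v n) (v l)) →
        (TE q q' ↔ TE' q q') := by
  have hV := @hT.vert
  have hE := @hT.edge
  have hV' := @hT'.vert
  have hE' := @hT'.edge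
  simp (decide := true) (maxDischargeDepth := 10) only [fSame, Fml.Sat, sat_allLt, sat_iff,
    val_pair, hV, hE, hV', hE', Agree.refl, Agree.updateN, hasN_pair, Tm.HasN, Tm.val,
    Function.update_self, Function.update_of_ne, ne_eq, not_false_eq_true, or_self]

/-- A homomorphism to `T` is a homomorphism to every irreducibility reduction of `T`: its
restriction shows that its values are not removed. -/
theorem isHom_of_fReduction {m : ℕ} {h : M.Sets} (hT : T.Realizes v w TV TE)
    (hT' : T'.Realizes v w TV' TE') (hX : ∀ p, M.lt p (v n) → M.mem p (w VX))
    (hred : (fReduction m T T').Sat M v w)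
    (hlen : M.lt (M.len h) (M.pair (v n) (M.pair (v n) (v l))))
    (hh : M.IsHom (v n) (v l) (w VX) (w EX) h TV TE) :
    M.IsHom (v n) (v l) (w VX) (w EX) h TV' TE' := by
  have hV := @hT.vert
  have hE := @hT.edge
  have hV' := @hT'.vert
  have hE' := @hT'.edge
  -- In `fSolvableAt` the formula `fHom` occurs below several quantifiers, so its meaning is needed
  -- at every agreeing assignment.
  have hH : ∀ v' w', Agree v w v' w' → ((fHom VX' EX' T).Sat M v' w' ↔
      M.IsHom (v' n) (v' l) (w' VX') (w' EX') (w' H) TV TE) :=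
    fun v' w' h => sat_fHom (hT.of_agree h)
  simp (decide := true) only [fReduction, sat_exLt, sat_exSLt, Fml.Sat, Tm.HasN, hasS_pair,
    Tm.HasS, or_self] at hred
  -- `x`, `y`, `σ₀` are the values of `i`, `j`, `σ`; `X₀` and `E₀` are the vertices and edges of the
  -- induced subgraph.
  obtain ⟨x, -, y, -, σ₀, -, I₀, X₀, E₀, -, -, hind, -, hrem⟩ := hred
  simp (decide := true) (maxDischargeDepth := 16) only [fRemoved, fSolvableAt, Target.dom, Fml.Sat,
    sat_allLt, sat_exSLt, sat_imp, sat_iff, val_pair, hV, hE, hV', hE', hH, Agree.refl,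
    Agree.updateN, Agree.updateS, hasN_pair, hasS_pair, Tm.HasN, Tm.HasS, Tm.val,
    Function.update_self, Function.update_of_ne, ne_eq, not_false_eq_true, or_self] at hrem
  simp (decide := true) only [fInduced, Fml.Sat, sat_allLt, sat_iff, val_pair,
    Tm.HasN, Tm.val, Function.update_self, Function.update_of_ne, ne_eq,
    not_false_eq_true] at hind
  obtain ⟨hsub, hdom, hedge⟩ := hrem
  -- Vertices below `n` lie in `VX` by `hX`, and edges of the induced subgraph are edges of `EX`.
  have hh' : M.IsHom (v n) (v l) X₀ E₀ h TV TE :=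
    hh.restrict (fun p hp _ => hX p hp)
      fun p hp p' hp' he => ((hind.2.2.2 p hp p' hp').1 he).2.2
  refine hh.shrink hsub (fun p hp a ha hpa haV => (hdom p hp a ha).2 ⟨haV, ?_⟩)
    fun q hq q' hq' he h1 h2 => (hedge q hq q' hq').2 ⟨he, h1, h2⟩
  -- Only the domain of `j` carries a removal condition. There `h` is itself the required solution
  -- through `a`; `hlen` meets the length bound in `fSolvableAt`.
  rintro rfl
  exact ⟨h, hlen, hh', hpa⟩

end Agree

-- Order facts from 2-BASIC and induction along the stages.

theorem Str.lt_of_add_one_le {M : Str} (hM : ∀ ψ, V1 ψ → M.Models ψ) {x y : M.Num}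
    (h : M.le (M.add x M.one) y) : M.lt x y := by
  have key : ¬ M.le y x := by
    intro hyx
    -- If `y ≤ x`, then `y < x + 1` by `b11`, while `x + 1 ≤ y` would force `y = x + 1` by
    -- antisymmetry `b7`.
    have h11 := hM _ (.b11 ⟨0⟩ ⟨1⟩) (fun z => if z = ⟨0⟩ then y else x)
      fun _ => M.sets_nonempty.some
    have h7 := hM _ (.b7 ⟨0⟩ ⟨1⟩) (fun z => if z = ⟨0⟩ then y else M.add x M.one)
      fun _ => M.sets_nonempty.some
    rw [sat_iff, sat_lt] at h11
    rw [sat_imp] at h7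
    exact (h11.1 hyx).2 (h7 ⟨(h11.1 hyx).1, h⟩)
  have h10 := fun z z' => hM _ (.b10 ⟨0⟩ ⟨1⟩) (fun u => if u = ⟨0⟩ then z else z')
      fun _ => M.sets_nonempty.some
  refine ⟨(h10 x y).resolve_right key, ?_⟩
  rintro rfl
  exact key ((h10 x x).elim id id)

theorem Str.le_refl {M : Str} (hM : ∀ ψ, V1 ψ → M.Models ψ) (x : M.Num) : M.le x x :=
  (hM _ (.b10 ⟨0⟩ ⟨0⟩) (fun _ => x) fun _ => M.sets_nonempty.some).elim id id

/-- `h` is a homomorphism from `(VX, EX)` to stage `z` of the sequence coded by `VW`, `EW`. -/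
def IsStageHom (M : Str) (v : NVar → M.Num) (w : SVar → M.Sets) (h : M.Sets) (z : M.Num) : Prop :=
  M.IsHom (v n) (v l) (w VX) (w EX) h (fun u => M.mem (M.pair z u) (w VW))
    fun u u' => M.mem (M.pair (M.pair z u) u') (w EW)

/-- A homomorphism to the first stage is a homomorphism to the last stage, by induction on the
stages. -/
theorem IsStageHom.last {M : Str} (hM : ∀ ψ, V1 ψ → M.Models ψ) {m : ℕ} {v : NVar → M.Num}
    {w : SVar → M.Sets} {h : M.Sets} (hX : ∀ p, M.lt p (v n) → M.mem p (w VX))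
    (hlen : M.lt (M.len h) (M.pair (v n) (M.pair (v n) (v l))))
    (hred : (Fml.allLt r s (fReduction m (stage r) (stage (r + 1)))).Sat M v w)
    (h0 : IsStageHom M v w h M.zero) : IsStageHom M v w h (v s) := by
  -- The guard `r ≤ s` is needed because reductions are only given for `r < s`. The free set
  -- variable `H` is assigned the fixed `h`.
  have hind := hM _ (.ind (r ≤ₙ s ⟹ fHom VX EX (stage r)) r
    (.base (.imp (.le _ _) (isSigma0_fHom (fun _ => .mem _ _) fun _ _ => .mem _ _)))) v
    (Function.update w H h)
  have e0 : Fml.subst r 0 (r ≤ₙ s ⟹ fHom VX EX (stage r)) =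
      (0 ≤ₙ s ⟹ fHom VX EX (stage 0)) := rfl
  have e1 : Fml.subst r (r + 1) (r ≤ₙ s ⟹ fHom VX EX (stage r)) =
      ((r : Tm) + 1 ≤ₙ s ⟹ fHom VX EX (stage (r + 1))) := rfl
  rw [e0, e1, sat_imp] at hind
  have hsr : s ≠ r := by decide
  rw [sat_allLt (t := (s : Tm)) hsr] at hred
  have real (z : M.Num) (w' : SVar → M.Sets) : (stage r).Realizes (Function.update v r z) w'
      (fun u => M.mem (M.pair z u) (w' VW)) fun u u' => M.mem (M.pair (M.pair z u) u') (w' EW) :=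
    stage_realizes fun h => h.1 r (by decide)
  have real' (z : M.Num) (w' : SVar → M.Sets) :
      (stage (r + 1)).Realizes (Function.update v r z) w'
        (fun u => M.mem (M.pair (M.add z M.one) u) (w' VW))
        fun u u' => M.mem (M.pair (M.pair (M.add z M.one) u) u') (w' EW) :=
    stage_realizes fun h => congrArg (M.add · M.one) (h.1 r (by decide))
  have real0 : (stage 0).Realizes v (Function.update w H h)
      (fun u => M.mem (M.pair M.zero u) (w VW))
      fun u u' => M.mem (M.pair (M.pair M.zero u) u') (w EW) :=
    stage_realizes fun _ => rfl
  have all := hind ⟨sat_imp.2 fun _ => (sat_fHom real0).2 h0,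
    fun z => sat_imp.2 fun ih => sat_imp.2 fun hz => ?_⟩ (v s)
  · exact (sat_fHom (real _ _)).1 (sat_imp.1 all (Str.le_refl hM (v s)))
  · have hz' : M.lt z (v s) := Str.lt_of_add_one_le hM hz
    have ih' : IsStageHom M v w h z := (sat_fHom (real _ _)).1 (sat_imp.1 ih hz'.1)
    -- `hred` holds under `w` without the update at `H`, so the reduction is read there; the notion
    -- of homomorphism takes `h` as an explicit argument.
    have step : IsStageHom M v w h (M.add z M.one) :=
      isHom_of_fReduction (v := Function.update v r z) (w := w) (real z w) (real' z w) hX (hred z hz') hlen ih'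
    exact (sat_fHom (real' _ _)).2 step

theorem proves_irreducibilitySoundness (m : ℕ) : Proves V1 (irreducibilitySoundness m) := by
  intro M hM v₀ w₀ l₀ n₀ s₀ Ω₀ VX₀ EX₀ VA₀ EA₀ Vir₀ Eir₀ VW₀ EW₀
  -- The quantified values are now read off arbitrary assignments `v` and `w`.
  generalize Function.update (β := fun _ => M.Sets) _ EW EW₀ = w
  generalize Function.update (β := fun _ => M.Num) _ s s₀ = v
  rw [sat_imp, sat_imp]
  rintro ⟨⟨-, hX, -⟩, hfirst, hred, hlast⟩ hsol
  have hnf : n ≠ f := by decide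
  rw [sat_allLt (t := (n : Tm)) hnf] at hX
  have hH : ¬ (⟪n, ⟪n, l⟫⟫ : Tm).HasS H := by simp [hasS_pair, Tm.HasS]
  rw [fSolvable, sat_exSLt hH] at hsol ⊢
  obtain ⟨h, hlen, hh⟩ := hsol
  refine ⟨h, hlen, ?_⟩
  -- `w'` is left arbitrary because `fHom` is evaluated after `H` has been assigned, and `fSame`
  -- before.
  have hA {w' : SVar → M.Sets} := target_realizes (v := v) (w := w') (V := VA) (E := EA)
    (by decide) (by decide)
  have hir {w' : SVar → M.Sets} := target_realizes (v := v) (w := w') (V := Vir) (E := Eir)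
    (by decide) (by decide)
  have hzero := (sat_fSame (stage_realizes (x := 0) (z := M.zero) fun _ => rfl) hA).1 hfirst
  have hs := (sat_fSame (stage_realizes (x := s) (z := v s) fun h => h.1 s (by decide)) hir).1 hlast
  have h0 : IsStageHom M v w h M.zero :=
    ((sat_fHom hA).1 hh).congr (fun q hq => (hzero.1 q hq).symm)
      fun q hq q' hq' => (hzero.2 q hq q' hq').symm
  exact (sat_fHom hir).2 ((h0.last hM hX hlen hred).congr hs.1 hs.2)

end BoundedArith

/-- `V¹` proves that the irreducibility reduction preserves solvability (over any algebra with one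
basic operation, of any fixed arity `m`). -/
theorem mainTheorem7 (m : ℕ) :
    BoundedArith.Proves BoundedArith.V1 (BoundedArith.irreducibilitySoundness m) := by
  exact BoundedArith.proves_irreducibilitySoundness m
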